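/- For $t\in\mathbb{C}$ let $X_t\subset\mathbb{P}^5_{\mathbb{C}}$ be the quartic threefold given by $$\sum_{i=0}^{5}x_i=0,\qquad \sum_{i=0}^{5}x_i^4=t\Big(\sum_{i=0}^{5}x_i^2\Big)^2 ,$$ regarded as a quartic hypersurface in the hyperplane $\mathbb{P}^4=\{\sum_{i=0}^5 x_i=0\}\subset\mathbb{P}^5_{\mathbb{C}}$. Then the threefolds $X_{\frac{1}{6}}$ and $X_{\frac{7}{10}}$ are rational; that is, each of them is birational over $\mathbb{C}$ to the affine space $\mathbb{A}^3_{\mathbb{C}}$ (equivalently, to $\mathbb{P}^3_{\mathbb{C}}$). -/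

import Mathlib

open CategoryTheory AlgebraicGeometry MvPolynomial

noncomputable section

attribute [local instance] MvPolynomial.gradedAlgebra

/-- The grading induced on `A ⧸ I` by a grading `𝒜` of `A`: the degree `d` part of `A ⧸ I` is the
image of the degree `d` part of `A`. -/
def quotientGrading {R A : Type*} [CommRing R] [CommRing A] [Algebra R A]
    (𝒜 : ℕ → Submodule R A) (I : Ideal A) (d : ℕ) : Submodule R (A ⧸ I) :=
  (𝒜 d).map (Ideal.Quotient.mkₐ R I).toLinearMap

/-- If `I` is a homogeneous ideal, then the induced grading makes `A ⧸ I` a graded algebra. -/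
@[reducible] def quotientGradedAlgebra {R A : Type*} [CommRing R] [CommRing A] [Algebra R A]
    (𝒜 : ℕ → Submodule R A) [GradedAlgebra 𝒜] (I : Ideal A) (hI : I.IsHomogeneous 𝒜) :
    GradedAlgebra (quotientGrading 𝒜 I) :=
  have hmon : SetLike.GradedMonoid (quotientGrading 𝒜 I) :=
    { one_mem := ⟨1, SetLike.one_mem_graded 𝒜, map_one (Ideal.Quotient.mkₐ R I)⟩
      mul_mem := by
        rintro i j _ _ ⟨a, ha, rfl⟩ ⟨b, hb, rfl⟩
        exact ⟨a * b, SetLike.mul_mem_graded ha hb, map_mul (Ideal.Quotient.mkₐ R I) a b⟩ }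
  let comp (d : ℕ) : 𝒜 d →ₗ[R] quotientGrading 𝒜 I d :=
    (Ideal.Quotient.mkₐ R I).toLinearMap.restrict fun a ha => ⟨a, ha, rfl⟩
  let pre : A →ₗ[R] DirectSum ℕ fun d => quotientGrading 𝒜 I d :=
    DirectSum.lmap comp ∘ₗ (DirectSum.decomposeLinearEquiv 𝒜).toLinearMap
  have hpre : ∀ a ∈ I, pre a = 0 := by
    intro a ha
    ext d
    exact Ideal.Quotient.eq_zero_iff_mem.2 (hI d ha)
  have hpre_mem : ∀ (d : ℕ) (a : A) (ha : a ∈ 𝒜 d),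
      pre a = DirectSum.of (fun d => quotientGrading 𝒜 I d) d ⟨Ideal.Quotient.mk I a, a, ha, rfl⟩ := by
    intro d a ha
    simp only [pre, LinearMap.comp_apply, LinearEquiv.coe_coe, DirectSum.decomposeLinearEquiv_apply,
      DirectSum.decompose_of_mem 𝒜 ha]
    exact DirectSum.lmap_lof comp d ⟨a, ha⟩
  let dec : A ⧸ I →+ DirectSum ℕ fun d => quotientGrading 𝒜 I d :=
    QuotientAddGroup.lift _ pre.toAddMonoidHom hpre
  { hmon with
    toDecomposition := DirectSum.Decomposition.ofAddHom _ dec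
      (by
        ext x
        obtain ⟨a, rfl⟩ := Ideal.Quotient.mk_surjective x
        change DirectSum.coeAddMonoidHom _ (pre a) = Ideal.Quotient.mk I a
        induction a using DirectSum.Decomposition.inductionOn 𝒜 with
        | zero => simp
        | homogeneous a => rw [hpre_mem _ a a.2, DirectSum.coeAddMonoidHom_of]
        | add a b ha hb => rw [map_add, map_add, ha, hb, map_add])
      (by
        ext d ⟨x, a, ha, rfl⟩ : 2
        change dec (DirectSum.coeAddMonoidHom _ (DirectSum.of _ d _)) = DirectSum.of _ d _
        rw [DirectSum.coeAddMonoidHom_of]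
        exact hpre_mem d a ha) }

/-- The linear form `x₀ + x₁ + x₂ + x₃ + x₄ + x₅`, whose zero locus is the hyperplane `ℙ⁴ ⊂ ℙ⁵`. -/
def hyperplaneForm : MvPolynomial (Fin 6) ℂ := ∑ i, X i

/-- The quartic form `∑ xᵢ⁴ - t (∑ xᵢ²)²`. -/
def quarticForm (t : ℂ) : MvPolynomial (Fin 6) ℂ := ∑ i, X i ^ 4 - C t * (∑ i, X i ^ 2) ^ 2

/-- The homogeneous ideal generated by the two equations of `X_t` in `ℙ⁵`. -/
def quarticIdeal (t : ℂ) : Ideal (MvPolynomial (Fin 6) ℂ) :=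
  Ideal.span {hyperplaneForm, quarticForm t}

theorem hyperplaneForm_isHomogeneous : hyperplaneForm.IsHomogeneous 1 :=
  IsHomogeneous.sum _ _ _ fun i _ => isHomogeneous_X ℂ i

theorem quarticForm_isHomogeneous (t : ℂ) : (quarticForm t).IsHomogeneous 4 := by
  refine IsHomogeneous.sub (IsHomogeneous.sum _ _ _ fun i _ => ?_) ?_
  · exact isHomogeneous_X_pow i 4
  · have h2 : (∑ i : Fin 6, (X i : MvPolynomial (Fin 6) ℂ) ^ 2).IsHomogeneous 2 :=
      IsHomogeneous.sum _ _ _ fun i _ => isHomogeneous_X_pow i 2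
    exact (h2.pow 2).C_mul t

theorem quarticIdeal_isHomogeneous (t : ℂ) :
    (quarticIdeal t).IsHomogeneous (homogeneousSubmodule (Fin 6) ℂ) := by
  refine Ideal.homogeneous_span _ _ ?_
  rintro _ (rfl | rfl)
  · exact ⟨1, hyperplaneForm_isHomogeneous⟩
  · exact ⟨4, quarticForm_isHomogeneous t⟩

/-- The grading of the homogeneous coordinate ring `ℂ[x₀, …, x₅] / (∑ xᵢ, ∑ xᵢ⁴ - t (∑ xᵢ²)²)`
of `X_t`. -/
abbrev quarticGrading (t : ℂ) : ℕ → Submodule ℂ (MvPolynomial (Fin 6) ℂ ⧸ quarticIdeal t) :=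
  quotientGrading (homogeneousSubmodule (Fin 6) ℂ) (quarticIdeal t)

instance quarticGradedAlgebra (t : ℂ) : GradedAlgebra (quarticGrading t) :=
  quotientGradedAlgebra _ _ (quarticIdeal_isHomogeneous t)

/-- The quartic threefold `X_t`: the closed subscheme
`∑ xᵢ = ∑ xᵢ⁴ - t (∑ xᵢ²)² = 0` of `ℙ⁵` over `ℂ`, that is, the scheme
`Proj ℂ[x₀, …, x₅] / (∑ xᵢ, ∑ xᵢ⁴ - t (∑ xᵢ²)²)`. -/
def quarticThreefold (t : ℂ) : Scheme.{0} := Proj (quarticGrading t)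

/-- The structure morphism `X_t ⟶ Spec ℂ`, induced by the inclusion of the constants `ℂ` into
the degree zero part of the homogeneous coordinate ring. -/
def quarticThreefoldStr (t : ℂ) : quarticThreefold t ⟶ Spec (.of ℂ) :=
  Proj.toSpecZero (quarticGrading t) ≫
    Spec.map (CommRingCat.ofHom (algebraMap ℂ (quarticGrading t 0)))

end

/-!
Both quartics are determinantal, and a determinantal quartic threefold is rational.

Let `M(y) = ∑ yⱼ Tⱼ` be a `4 × 4` matrix of linear forms in five variables whose determinant is the
equation of the quartic in its hyperplane `ℙ⁴`. A general point `y` of the quartic has a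
one-dimensional kernel `v = toKernel T y`, given by cubic cofactors of `M(y)`. Conversely, for a
general `v` in `ℙ³` the equation `M(y) v = 0` is a system of four linear equations in five unknowns,
with a unique solution `y = ofKernel T v` up to scalars, given by the quartic maximal minors of the
system. Each map recovers the other by Cramer's rule for homogeneous systems
(`mul_topCofactors_comm`). On coordinate rings this says that the affine chart `y₀ ≠ 0` of the quartic
and the polynomial ring in three variables have a common localization (`isLocalization_away_chart`).
Its spectrum is an open subscheme of both `X_t` and `𝔸³`, and it is dense in `X_t` since `X_t` is
irreducible (`quarticIdeal_isPrime`, by Eisenstein's criterion on a plane section). This gives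
`birationalOver_of_det`.

The determinantal representations are `oneSixthMatrix` and `sevenTenthsMatrix`. They are compatible
with the stabilizer in the alternating group of a partition of the six coordinates into three pairs:
the Klein four-group that exchanges the members of two of the pairs acts on the row and column spaces
through the quaternion group, so that the differences of the pairs enter through the Pauli matrices,
and the cyclic permutation of the pairs acts through a cube root of unity.
-/

noncomputable section

attribute [local instance] MvPolynomial.gradedAlgebra

/-! ### Cofactors and homogeneous linear systems -/

section Cofactors
open Matrix
variable {R S : Type*} [CommRing R] [CommRing S] {n : ℕ}

/-- The cofactors of the top row of a square matrix, i.e. the signed maximal minors of the matrix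
without its top row. They do not depend on the top row, and span the kernel of the remaining rows
when these are linearly independent. -/
def topCofactors (A : Matrix (Fin (n + 1)) (Fin (n + 1)) R) (j : Fin (n + 1)) : R :=
  A.adjugate j 0

theorem topCofactors_updateRow (A : Matrix (Fin (n + 1)) (Fin (n + 1)) R) (w : Fin (n + 1) → R) :
    topCofactors (A.updateRow 0 w) = topCofactors A := by
  ext j
  simp [topCofactors, adjugate_apply]

theorem dotProduct_topCofactors (A : Matrix (Fin (n + 1)) (Fin (n + 1)) R) :
    A 0 ⬝ᵥ topCofactors A = A.det := by
  have h := congrFun (congrFun (mul_adjugate A) 0) 0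
  simpa [Matrix.mul_apply, dotProduct, topCofactors] using h

theorem mulVec_topCofactors (A : Matrix (Fin (n + 1)) (Fin (n + 1)) R) :
    A *ᵥ topCofactors A = Pi.single 0 A.det := by
  ext i
  have h := congrFun (congrFun (mul_adjugate A) i) 0
  simp only [Matrix.mul_apply, Matrix.smul_apply, Matrix.one_apply, smul_eq_mul] at h
  rw [mulVec, dotProduct]
  simp only [topCofactors, h, Pi.single_apply, mul_ite, mul_one, mul_zero]

/-- Cramer's rule for a homogeneous system of `n` equations in `n + 1` unknowns: every solution is
proportional to the vector of signed maximal minors. -/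
theorem mul_topCofactors_comm (A : Matrix (Fin (n + 1)) (Fin (n + 1)) R) (y : Fin (n + 1) → R)
    (hy : ∀ i, i ≠ 0 → (A *ᵥ y) i = 0) (i j : Fin (n + 1)) :
    y i * topCofactors A j = y j * topCofactors A i := by
  -- Replace the irrelevant top row by the `i`-th coordinate vector.
  set K := A.updateRow 0 (Pi.single i 1) with hK
  have hKy : K *ᵥ y = Pi.single 0 (y i) := by
    ext k
    rcases eq_or_ne k 0 with rfl | hk
    · simp [hK, mulVec]
    · simpa [hK, mulVec, updateRow_ne hk, hk] using hy k hk
  have h1 : topCofactors K i = K.det := by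
    rw [← dotProduct_topCofactors K]
    simp [hK]
  have h2 : K.adjugate *ᵥ (K *ᵥ y) = K.det • y := by
    rw [mulVec_mulVec, adjugate_mul, smul_mulVec, one_mulVec]
  have h3 := congrFun h2 j
  rw [hKy, mulVec_single] at h3
  simp only [Pi.smul_apply, col_apply, MulOpposite.smul_eq_mul_unop, MulOpposite.unop_op,
    smul_eq_mul] at h3
  rw [← topCofactors_updateRow A (Pi.single i 1), ← hK, h1]
  change topCofactors K j * y i = _ at h3
  linear_combination h3

theorem topCofactors_smul (c : R) (A : Matrix (Fin (n + 1)) (Fin (n + 1)) R) :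
    topCofactors (c • A) = c ^ n • topCofactors A := by
  ext j
  simp [topCofactors, adjugate_smul]

theorem map_topCofactors (f : R →+* S) (A : Matrix (Fin (n + 1)) (Fin (n + 1)) R)
    (j : Fin (n + 1)) : f (topCofactors A j) = topCofactors (A.map f) j := by
  simp only [topCofactors]
  exact congrFun (congrFun (RingHom.map_adjugate f A) j) 0

end Cofactors

/-! ### Matrices of linear forms and their kernel maps -/

section Pencil
open Matrix

variable {K : Type*} [Field K] (T : Fin 5 → Matrix (Fin 4) (Fin 4) K)
variable {R S : Type*} [CommRing R] [CommRing S] [Algebra K R] [Algebra K S]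

/-- The `4 × 4` matrix of linear forms `∑ yⱼ Tⱼ` evaluated at a point `y` of the affine cone over
`ℙ⁴`. -/
def pencil (y : Fin 5 → R) : Matrix (Fin 4) (Fin 4) R :=
  ∑ j, y j • (T j).map (algebraMap K R)

/-- The matrix of the linear map `y ↦ (∑ yⱼ Tⱼ) v`, padded with a zero row on top to make it
square. -/
def transposedPencil (v : Fin 4 → R) : Matrix (Fin 5) (Fin 5) R :=
  fun i j => Fin.cases 0 (fun i' => ((T j).map (algebraMap K R) *ᵥ v) i') i

theorem transposedPencil_mulVec_succ (v : Fin 4 → R) (y : Fin 5 → R) (i : Fin 4) :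
    (transposedPencil T v *ᵥ y) i.succ = (pencil T y *ᵥ v) i := by
  simp only [pencil, Matrix.sum_mulVec, Matrix.smul_mulVec, Finset.sum_apply, Pi.smul_apply]
  simp [transposedPencil, Matrix.mulVec, dotProduct, mul_comm]

theorem pencil_smul (c : R) (y : Fin 5 → R) : pencil T (c • y) = c • pencil T y := by
  simp [pencil, Finset.smul_sum, smul_smul]

theorem transposedPencil_smul (c : R) (v : Fin 4 → R) :
    transposedPencil T (c • v) = c • transposedPencil T v := by
  ext i j
  refine Fin.cases ?_ (fun i' => ?_) i
  · simp [transposedPencil]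
  · simp [transposedPencil, mulVec_smul]

theorem map_pencil (f : R →ₐ[K] S) (y : Fin 5 → R) :
    (pencil T y).map f = pencil T (fun j => f (y j)) := by
  ext i k
  simp [pencil, Matrix.sum_apply]

theorem map_transposedPencil (f : R →ₐ[K] S) (v : Fin 4 → R) :
    (transposedPencil T v).map f = transposedPencil T (fun j => f (v j)) := by
  ext i j
  refine Fin.cases ?_ (fun i' => ?_) i
  · simp [transposedPencil]
  · simp [transposedPencil, mulVec, dotProduct]

/-- The cubic map from the determinantal quartic to `ℙ³`: the kernel vector of `∑ yⱼ Tⱼ`. -/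
def toKernel (y : Fin 5 → R) : Fin 4 → R := topCofactors (pencil T y)

/-- The quartic map from `ℙ³` to the determinantal quartic: the solution `y` of
`(∑ yⱼ Tⱼ) v = 0`. -/
def ofKernel (v : Fin 4 → R) : Fin 5 → R := topCofactors (transposedPencil T v)

theorem toKernel_smul (c : R) (y : Fin 5 → R) : toKernel T (c • y) = c ^ 3 • toKernel T y := by
  rw [toKernel, pencil_smul, topCofactors_smul, toKernel]

theorem ofKernel_smul (c : R) (v : Fin 4 → R) : ofKernel T (c • v) = c ^ 4 • ofKernel T v := by
  rw [ofKernel, transposedPencil_smul, topCofactors_smul, ofKernel]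

theorem map_toKernel (f : R →ₐ[K] S) (y : Fin 5 → R) (i : Fin 4) :
    f (toKernel T y i) = toKernel T (fun j => f (y j)) i := by
  rw [toKernel, toKernel, ← map_pencil]
  exact map_topCofactors (f : R →+* S) _ i

theorem map_ofKernel (f : R →ₐ[K] S) (v : Fin 4 → R) (j : Fin 5) :
    f (ofKernel T v j) = ofKernel T (fun i => f (v i)) j := by
  rw [ofKernel, ofKernel, ← map_transposedPencil]
  exact map_topCofactors (f : R →+* S) _ j

theorem pencil_mulVec_toKernel {y : Fin 5 → R} (hy : (pencil T y).det = 0) :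
    pencil T y *ᵥ toKernel T y = 0 := by
  rw [toKernel, mulVec_topCofactors, hy, Pi.single_zero]

theorem pencil_ofKernel_mulVec (v : Fin 4 → R) : pencil T (ofKernel T v) *ᵥ v = 0 := by
  ext i
  rw [← transposedPencil_mulVec_succ, ofKernel, mulVec_topCofactors]
  simp

/-- The point `y` is determined up to a factor by the kernel vector `v`. -/
theorem ofKernel_comm {y : Fin 5 → R} {v : Fin 4 → R} (h : pencil T y *ᵥ v = 0) (i j : Fin 5) :
    y i * ofKernel T v j = y j * ofKernel T v i := by
  refine mul_topCofactors_comm _ _ (fun k hk => ?_) i j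
  obtain ⟨k, rfl⟩ := Fin.exists_succ_eq.2 hk
  rw [transposedPencil_mulVec_succ, h, Pi.zero_apply]

/-- The kernel vector `v` is determined up to a factor by the point `y`. -/
theorem toKernel_comm {y : Fin 5 → R} {v : Fin 4 → R} (h : pencil T y *ᵥ v = 0) (i j : Fin 4) :
    v i * toKernel T y j = v j * toKernel T y i :=
  mul_topCofactors_comm _ _ (fun k _ => by rw [h, Pi.zero_apply]) i j

theorem det_pencil_ofKernel {v : Fin 4 → R} (hv : v 0 = 1) :
    (pencil T (ofKernel T v)).det = 0 := by
  have h : (pencil T (ofKernel T v)).adjugate *ᵥ (pencil T (ofKernel T v) *ᵥ v) =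
      (pencil T (ofKernel T v)).det • v := by
    rw [mulVec_mulVec, adjugate_mul, smul_mulVec, one_mulVec]
  simpa [pencil_ofKernel_mulVec, hv] using (congrFun h 0).symm

end Pencil

/-! ### Common affine charts of a determinantal quartic and of projective space -/

section Chart
open Matrix
variable {K : Type} [Field K] (T : Fin 5 → Matrix (Fin 4) (Fin 4) K)

/-- The generic point `(1 : a : b : c)` of the affine chart of `ℙ³`. -/
def genericKernel (K : Type) [Field K] : Fin 4 → MvPolynomial (Fin 3) K :=
  Fin.cons 1 X

/-- The image of the generic point of `ℙ³` in the determinantal quartic. -/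
def genericImage : Fin 5 → MvPolynomial (Fin 3) K := ofKernel T (genericKernel K)

/-- The polynomial on `𝔸³` away from which the parametrization `ofKernel` is inverse to the
kernel map between the affine charts. -/
def chartPoly : MvPolynomial (Fin 3) K :=
  genericImage T 0 * toKernel T (genericImage T) 0

/-- The charts are nonempty as soon as the two maps are defined at one pair `(y, v)`. -/
theorem chartPoly_ne_zero {v : Fin 4 → K} {y : Fin 5 → K} (hv : v 0 = 1) (hy : y 0 = 1)
    (h : pencil T y *ᵥ v = 0) (h₁ : ofKernel T v 0 ≠ 0) (h₂ : toKernel T y 0 ≠ 0) :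
    chartPoly T ≠ 0 := by
  intro h0
  let f : MvPolynomial (Fin 3) K →ₐ[K] K := aeval fun k => v k.succ
  have hf : (fun i => f (genericKernel K i)) = v := by
    ext i
    refine Fin.cases ?_ (fun k => ?_) i <;> simp [f, genericKernel, hv]
  have hP : (fun j => f (genericImage T j)) = ofKernel T v := by
    ext j
    rw [genericImage, map_ofKernel, hf]
  have hP' : ofKernel T v = ofKernel T v 0 • y := by
    ext j
    have := ofKernel_comm T h 0 j
    rw [hy, one_mul] at this
    rw [this, Pi.smul_apply, smul_eq_mul, mul_comm]
  have h3 := congrArg f h0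
  rw [chartPoly, map_mul, map_zero, map_toKernel, hP, congrFun hP 0, hP', toKernel_smul,
    Pi.smul_apply, smul_eq_mul, Pi.smul_apply, hy, smul_eq_mul, mul_one] at h3
  exact mul_ne_zero h₁ (mul_ne_zero (pow_ne_zero 3 h₁) h₂) h3

theorem map_toKernel_mul_ofKernel {R S : Type*} [CommRing R] [CommRing S] [Algebra K R]
    [Algebra K S] (f : R →ₐ[K] S) (y : Fin 5 → R) :
    f (toKernel T y 0 * ofKernel T (toKernel T y) 0) =
      toKernel T (fun j => f (y j)) 0 * ofKernel T (toKernel T fun j => f (y j)) 0 := by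
  rw [map_mul, map_ofKernel, map_toKernel]
  congr 2
  ext i
  rw [map_toKernel]

/-- The coordinate ring `R₀` of the affine chart `y₀ ≠ 0` of the determinantal quartic and the
polynomial ring in three variables have a common localization. -/
theorem isLocalization_away_chart {R₀ S : Type} [CommRing R₀] [Algebra K R₀] [CommRing S]
    [Algebra K S] [Algebra (MvPolynomial (Fin 3) K) S]
    [IsScalarTower K (MvPolynomial (Fin 3) K) S] [IsLocalization.Away (chartPoly T) S]
    (t : Fin 5 → R₀) (ht : t 0 = 1) (hdet : (pencil T t).det = 0)
    (hgen : Algebra.adjoin K (Set.range t) = ⊤) (ρ : R₀ →ₐ[K] S)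
    (hρ : ∀ j, ρ (t j) * algebraMap _ S (genericImage T 0) = algebraMap _ S (genericImage T j)) :
    letI := ρ.toAlgebra
    IsLocalization.Away (toKernel T t 0 * ofKernel T (toKernel T t) 0) S := by
  let := ρ.toAlgebra
  have : IsScalarTower K R₀ S := .of_algebraMap_eq fun x => (ρ.commutes x).symm
  set g := toKernel T t 0 * ofKernel T (toKernel T t) 0
  let ι : MvPolynomial (Fin 3) K →ₐ[K] S := IsScalarTower.toAlgHom K _ S
  let R' := Localization.Away g
  let γ : R₀ →ₐ[K] R' := IsScalarTower.toAlgHom K R₀ R'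
  -- The images in `S` of the generic points of `ℙ³` and of the quartic.
  let v : Fin 4 → S := fun i => ι (genericKernel K i)
  have hv0 : v 0 = 1 := by simp [v, genericKernel]
  let P : Fin 5 → S := fun j => ι (genericImage T j)
  have hP : P = ofKernel T v := by
    ext j
    simp only [P, genericImage, map_ofKernel, v]
  have hunit : IsUnit (ι (chartPoly T)) := IsLocalization.Away.algebraMap_isUnit _
  have hunit' : IsUnit (P 0 * toKernel T P 0) := by
    have : ι (chartPoly T) = P 0 * toKernel T P 0 := by
      rw [chartPoly, map_mul, map_toKernel]
    rwa [← this]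
  have hP0 : IsUnit (P 0) := isUnit_of_mul_isUnit_left hunit'
  have huP : IsUnit (toKernel T P 0) := isUnit_of_mul_isUnit_right hunit'
  -- The image of `t`, which is the generic image normalized to have zeroth coordinate `1`.
  let p : Fin 5 → S := fun j => ρ (t j)
  have hp : P = P 0 • p := by
    ext j
    simpa [mul_comm, P, p, ι] using (hρ j).symm
  have hup : IsUnit (toKernel T p 0) := by
    rw [hp, toKernel_smul] at huP
    exact isUnit_of_mul_isUnit_right huP
  have hMp : pencil T p *ᵥ v = 0 := by
    have h := pencil_ofKernel_mulVec T v
    rw [← hP, hp, pencil_smul, smul_mulVec] at h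
    ext i
    exact hP0.mul_left_cancel (by simpa using congrFun h i)
  have hupv : toKernel T p = toKernel T p 0 • v := by
    ext i
    have := toKernel_comm T hMp 0 i
    rw [hv0, one_mul] at this
    rw [this, Pi.smul_apply, smul_eq_mul, mul_comm]
  have hρg : IsUnit (ρ g) := by
    have h1 : ρ g = toKernel T p 0 * ofKernel T (toKernel T p) 0 :=
      map_toKernel_mul_ofKernel T ρ t
    rw [h1, hupv, ofKernel_smul, ← hP]
    simp only [Pi.smul_apply, smul_eq_mul, hv0, mul_one]
    exact hup.mul ((hup.pow 4).mul hP0)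
  -- The images in `R'` of the point `t` of the quartic and of its kernel vector `u`.
  let t' : Fin 5 → R' := fun j => γ (t j)
  have ht' : t' 0 = 1 := by simp [t', ht]
  let u : Fin 4 → R' := toKernel T t'
  have hdet' : (pencil T t').det = 0 := by
    rw [← map_pencil]
    have := congrArg γ hdet
    rw [map_zero] at this
    rw [← this]
    exact (RingHom.map_det (γ : R₀ →+* R') _).symm
  have hγg : IsUnit (u 0 * ofKernel T u 0) := by
    have h1 : γ g = u 0 * ofKernel T u 0 := map_toKernel_mul_ofKernel T γ t
    rw [← h1]
    exact IsLocalization.Away.algebraMap_isUnit g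
  have hu0 : IsUnit (u 0) := isUnit_of_mul_isUnit_left hγg
  have hPu : IsUnit (ofKernel T u 0) := isUnit_of_mul_isUnit_right hγg
  obtain ⟨d, hd⟩ := hu0.exists_right_inv
  have hdu : IsUnit d := .of_mul_eq_one (u 0) (by rw [mul_comm, hd])
  let w : Fin 4 → R' := d • u
  have hw0 : w 0 = 1 := by simp [w, mul_comm d, hd]
  have hPut : ofKernel T u = ofKernel T u 0 • t' := by
    ext j
    have := ofKernel_comm T (pencil_mulVec_toKernel T hdet') 0 j
    rw [ht', one_mul] at this
    rw [Pi.smul_apply, smul_eq_mul, mul_comm]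
    exact this
  have hPw : ofKernel T w = (d ^ 4 * ofKernel T u 0) • t' := by
    rw [ofKernel_smul, mul_smul, ← hPut]
  have hc : IsUnit (d ^ 4 * ofKernel T u 0) := (hdu.pow 4).mul hPu
  -- The inverse of the localization of `ρ` sends the generic point of `ℙ³` to `w = u / u₀`.
  let σ₀ : MvPolynomial (Fin 3) K →ₐ[K] R' := aeval fun k => w k.succ
  have hσv : (fun i => σ₀ (genericKernel K i)) = w := by
    ext i
    refine Fin.cases ?_ (fun k => ?_) i <;> simp [σ₀, genericKernel, hw0]
  have hσP : (fun j => σ₀ (genericImage T j)) = ofKernel T w := by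
    ext j
    rw [genericImage, map_ofKernel, hσv]
  have hσh : IsUnit (σ₀ (chartPoly T)) := by
    rw [chartPoly, map_mul, map_toKernel, hσP, congrFun hσP 0, hPw, toKernel_smul]
    simp only [Pi.smul_apply, smul_eq_mul, ht', mul_one]
    exact hc.mul ((hc.pow 3).mul hu0)
  let σ : S →+* R' := IsLocalization.Away.lift (chartPoly T) (g := (σ₀ : _ →+* R')) hσh
  have hσι : ∀ z, σ (ι z) = σ₀ z := fun z => IsLocalization.Away.lift_eq _ hσh z
  let τ : R' →+* S := IsLocalization.Away.lift g (g := (ρ : R₀ →+* S)) hρg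
  have hτγ : ∀ z, τ (γ z) = ρ z := fun z => IsLocalization.Away.lift_eq _ hρg z
  have hσK : ∀ z : K, σ (algebraMap K S z) = algebraMap K R' z := fun z => by
    rw [← ι.commutes, hσι, σ₀.commutes]
  have hτK : ∀ z : K, τ (algebraMap K R' z) = algebraMap K S z := fun z => by
    rw [← γ.commutes, hτγ, ρ.commutes]
  have hσρ : ∀ r, σ (ρ r) = γ r := by
    let σρ : R₀ →ₐ[K] R' :=
      { σ.comp (ρ : R₀ →+* S) with commutes' := fun z => by simp [hσK] }
    have : σρ = γ := by
      refine AlgHom.ext_of_adjoin_eq_top hgen ?_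
      rintro _ ⟨j, rfl⟩
      refine hc.mul_right_cancel ?_
      have h1 := congrArg σ (hρ j)
      rw [map_mul] at h1
      change σ (ρ (t j)) * σ (ι _) = σ (ι _) at h1
      rw [hσι, hσι, congrFun hσP 0, congrFun hσP j, hPw] at h1
      simp only [Pi.smul_apply, smul_eq_mul, ht', mul_one] at h1
      rw [mul_comm _ (t' j)] at h1
      exact h1
    exact fun r => DFunLike.congr_fun this r
  have hτσ : ∀ z, τ (σ z) = z := by
    have h0 : (τ.comp σ).comp (algebraMap (MvPolynomial (Fin 3) K) S) = algebraMap _ S := by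
      refine MvPolynomial.ringHom_ext (fun z => ?_) (fun k => ?_)
      · change τ (σ (ι (C z))) = ι (C z)
        rw [hσι, ← algebraMap_eq, σ₀.commutes, hτK, ι.commutes]
      · change τ (σ (ι (X k))) = ι (X k)
        have hτu : ∀ i, τ (u i) = toKernel T p i := fun i => by
          let τ' : R' →ₐ[K] S := { τ with commutes' := hτK }
          change τ' (u i) = _
          rw [map_toKernel]
          congr 1
          ext j
          exact hτγ (t j)
        have h1 : σ₀ (X k) * u 0 = u k.succ := by
          simp only [σ₀, aeval_X, w, Pi.smul_apply, smul_eq_mul]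
          linear_combination u k.succ * hd
        have h2 := congrArg τ h1
        rw [map_mul, hτu, hτu, hupv] at h2
        simp only [Pi.smul_apply, smul_eq_mul, hv0, mul_one] at h2
        rw [hσι]
        refine hup.mul_right_cancel ?_
        rw [h2, mul_comm]
        simp [v, genericKernel]
    have h1 : τ.comp σ = RingHom.id S :=
      IsLocalization.ringHom_ext (Submonoid.powers (chartPoly T)) (by rw [h0]; rfl)
    exact fun z => DFunLike.congr_fun h1 z
  have hστ : ∀ z, σ (τ z) = z := by
    have h1 : σ.comp τ = RingHom.id R' :=
      IsLocalization.ringHom_ext (Submonoid.powers g) (by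
        ext z
        change σ (τ (γ z)) = γ z
        rw [hτγ, hσρ])
    exact fun z => DFunLike.congr_fun h1 z
  let e : R' ≃ₐ[R₀] S :=
    { τ with
      invFun := σ
      left_inv := hστ
      right_inv := hτσ
      commutes' := hτγ }
  exact IsLocalization.isLocalization_of_algEquiv (Submonoid.powers g) e

end Chart

/-! ### Irreducibility of the quartic threefolds -/

section Prime

/-- Eisenstein's criterion at the prime `z` of `ℂ[z]` for a monic biquadratic polynomial. -/
theorem irreducible_biquadratic (b c : Polynomial ℂ) (hc : c.eval 0 ≠ 0) :
    Irreducible (Polynomial.X ^ 4 + Polynomial.C (Polynomial.X * b) * Polynomial.X ^ 2 +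
      Polynomial.C (Polynomial.X * c) : Polynomial (Polynomial ℂ)) := by
  set f : Polynomial (Polynomial ℂ) := Polynomial.X ^ 4 +
    Polynomial.C (Polynomial.X * b) * Polynomial.X ^ 2 + Polynomial.C (Polynomial.X * c) with hf
  have hdeg : f.natDegree = 4 := by
    rw [hf]
    compute_degree!
  have hmon : f.Monic := by
    rw [hf]
    monicity!
  have hprime : (Ideal.span {(Polynomial.X : Polynomial ℂ)}).IsPrime :=
    (Ideal.span_singleton_prime Polynomial.X_ne_zero).2 Polynomial.prime_X
  refine Polynomial.IsEisensteinAt.irreducible (𝓟 := Ideal.span {Polynomial.X})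
    ⟨?_, ?_, ?_⟩ hprime hmon.isPrimitive (by omega)
  · rw [hmon.leadingCoeff]
    exact (Ideal.ne_top_iff_one _).1 hprime.ne_top
  · intro n hn
    rw [hdeg] at hn
    rw [Ideal.mem_span_singleton, hf]
    interval_cases n <;>
      simp [-map_mul, Polynomial.coeff_C_mul, Polynomial.coeff_X_pow, Polynomial.coeff_C]
  · rw [Ideal.span_singleton_pow, Ideal.mem_span_singleton]
    rintro ⟨d, hd⟩
    have h0 : f.coeff 0 = Polynomial.X * c := by simp [hf]
    rw [h0, pow_two, mul_assoc] at hd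
    have h1 := mul_left_cancel₀ Polynomial.X_ne_zero hd
    exact hc (by rw [h1]; simp)

/-- Eliminates `x₅` by the linear equation and takes `x₀` as the main variable, the others being
`s = x₀ + x₁`, `x₂`, `x₃` and `x₄`. -/
def eliminate : MvPolynomial (Fin 6) ℂ →ₐ[ℂ] Polynomial (MvPolynomial (Fin 4) ℂ) :=
  aeval ![Polynomial.X, Polynomial.C (X 0) - Polynomial.X, Polynomial.C (X 1),
    Polynomial.C (X 2), Polynomial.C (X 3), Polynomial.C (-(X 0 + X 1 + X 2 + X 3))]

/-- A section of `eliminate`. -/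
def uneliminate : Polynomial (MvPolynomial (Fin 4) ℂ) →+* MvPolynomial (Fin 6) ℂ :=
  Polynomial.eval₂RingHom
    (aeval ![X 0 + X 1, X 2, X 3, X 4] : MvPolynomial (Fin 4) ℂ →ₐ[ℂ] MvPolynomial (Fin 6) ℂ)
    (X 0)

theorem eliminate_hyperplaneForm : eliminate hyperplaneForm = 0 := by
  simp [hyperplaneForm, eliminate, Fin.sum_univ_six]

theorem uneliminate_eliminate_sub_mem (p : MvPolynomial (Fin 6) ℂ) :
    uneliminate (eliminate p) - p ∈ Ideal.span {hyperplaneForm} := by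
  rw [← Ideal.Quotient.mk_eq_mk_iff_sub_mem]
  have : ((Ideal.Quotient.mk (Ideal.span {hyperplaneForm})).comp
      (uneliminate.comp (eliminate : _ →+* _))) =
      Ideal.Quotient.mk (Ideal.span {hyperplaneForm}) := by
    refine MvPolynomial.ringHom_ext (fun z => ?_) (fun i => ?_)
    · have h1 : eliminate (C z) = Polynomial.C (C z) := by
        rw [← algebraMap_eq, AlgHom.commutes]
        rfl
      simp [uneliminate, h1]
    · fin_cases i
      · simp [uneliminate, eliminate]
      · simp [uneliminate, eliminate]
      · simp [uneliminate, eliminate]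
      · simp [uneliminate, eliminate]
      · simp [uneliminate, eliminate]
      · simp only [uneliminate, eliminate, RingHom.comp_apply]
        rw [Ideal.Quotient.mk_eq_mk_iff_sub_mem, ← neg_mem_iff]
        convert! Ideal.mem_span_singleton_self hyperplaneForm using 1
        simp [hyperplaneForm, Fin.sum_univ_six]
        ring
  exact DFunLike.congr_fun this p

theorem quarticIdeal_eq_comap (t : ℂ) :
    quarticIdeal t = (Ideal.span {eliminate (quarticForm t)}).comap eliminate := by
  have hle : Ideal.span {hyperplaneForm} ≤ quarticIdeal t :=
    Ideal.span_mono (Set.singleton_subset_iff.2 (Set.mem_insert _ _))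
  have hq : quarticForm t ∈ quarticIdeal t := Ideal.subset_span (by simp)
  apply le_antisymm
  · refine Ideal.span_le.2 ?_
    rintro _ (rfl | rfl)
    · simp [eliminate_hyperplaneForm]
    · exact Ideal.mem_span_singleton_self _
  · intro p hp
    obtain ⟨q, hq'⟩ := Ideal.mem_span_singleton.1 (Ideal.mem_comap.1 hp)
    have h1 := hle (uneliminate_eliminate_sub_mem p)
    have h2 := hle (uneliminate_eliminate_sub_mem (quarticForm t))
    change eliminate p = _ at hq'
    rw [hq', map_mul] at h1
    have h3 : uneliminate (eliminate (quarticForm t)) ∈ quarticIdeal t := by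
      simpa using add_mem h2 hq
    have h4 := sub_mem ((quarticIdeal t).mul_mem_right (uneliminate q) h3) h1
    simpa using h4

theorem exists_primitive_cube_root : ∃ w : ℂ, w ^ 2 + w + 1 = 0 := by
  obtain ⟨w, hw⟩ := IsAlgClosed.exists_root (Polynomial.X ^ 2 + Polynomial.X + 1 : Polynomial ℂ)
    (by
      have : (Polynomial.X ^ 2 + Polynomial.X + 1 : Polynomial ℂ).degree = 2 := by
        compute_degree!
      simp [this])
  exact ⟨w, by simpa using hw⟩

/-- The ideal of `X_t` is prime for `t ≠ 1/2`: some plane section of `X_t` is a quartic curve with a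
smooth point at which the tangent line is a hyperflex, and Eisenstein's criterion applies to the
affine equation of such a curve. -/
theorem quarticIdeal_isPrime (t : ℂ) (ht : 2 - 4 * t ≠ 0) : (quarticIdeal t).IsPrime := by
  obtain ⟨w, hw⟩ := exists_primitive_cube_root
  set G := eliminate (quarticForm t) with hG
  set r : ℂ := (2 - 4 * t)⁻¹ with hr
  have hr1 : r * (2 - 4 * t) = 1 := inv_mul_cancel₀ ht
  have hr0 : r ≠ 0 := inv_ne_zero ht
  let f : Polynomial (MvPolynomial (Fin 4) ℂ) := Polynomial.C (C r) * G
  have hGf : G = (Polynomial.X ^ 4 + (Polynomial.C (X 0) - Polynomial.X) ^ 4 +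
      Polynomial.C (X 1 ^ 4 + X 2 ^ 4 + X 3 ^ 4 + (X 0 + X 1 + X 2 + X 3) ^ 4)) -
      Polynomial.C (C t) * (Polynomial.X ^ 2 + (Polynomial.C (X 0) - Polynomial.X) ^ 2 +
      Polynomial.C (X 1 ^ 2 + X 2 ^ 2 + X 3 ^ 2 + (X 0 + X 1 + X 2 + X 3) ^ 2)) ^ 2 := by
    have h1 : eliminate (C t) = Polynomial.C (C t) := by
      rw [← algebraMap_eq, AlgHom.commutes]
      rfl
    simp only [hG, quarticForm, Fin.sum_univ_six, map_sub, map_add, map_pow, map_mul, h1]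
    simp [eliminate]
    ring
  have hmon : f.Monic := by
    refine Polynomial.monic_of_natDegree_le_of_coeff_eq_one 4 ?_ ?_
    · simp only [f, hGf]
      compute_degree
    · have h1 : G.coeff 4 = C (2 - 4 * t) := by
        have h2 : G = Polynomial.C (C (2 - 4 * t)) * Polynomial.X ^ 4 +
            (G - Polynomial.C (C (2 - 4 * t)) * Polynomial.X ^ 4) := by ring
        have h3 : (G - Polynomial.C (C (2 - 4 * t)) * Polynomial.X ^ 4).natDegree ≤ 3 := by
          rw [hGf]
          simp only [map_sub, map_mul, map_ofNat]
          ring_nf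
          compute_degree
        rw [h2, Polynomial.coeff_add, Polynomial.coeff_eq_zero_of_natDegree_lt
          (Nat.lt_of_le_of_lt h3 (by norm_num)), Polynomial.coeff_C_mul_X_pow]
        simp
      rw [Polynomial.coeff_C_mul, h1, ← C_mul, hr1, C_1]
  have hirr : Irreducible f := by
    -- The point is `(0, 0, 0, 1, w, w²)`, the hyperflex has direction `(1, -1, 0, 0, 0, 0)`, and the
    -- plane is swept out by the parallels to it through `(0, 0, -z, 1 + z, w, w²)`.
    let φ : MvPolynomial (Fin 4) ℂ →ₐ[ℂ] Polynomial ℂ :=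
      aeval ![0, -Polynomial.X, 1 + Polynomial.X, Polynomial.C w]
    refine Polynomial.Monic.irreducible_of_irreducible_map
      (φ : MvPolynomial (Fin 4) ℂ →+* Polynomial ℂ) f hmon ?_
    have key := irreducible_biquadratic (-Polynomial.C (8 * t * r) * (1 + Polynomial.X))
      (Polynomial.C r * (4 + 6 * Polynomial.X + 4 * Polynomial.X ^ 2 + 2 * Polynomial.X ^ 3 -
        4 * Polynomial.C t * Polynomial.X * (1 + Polynomial.X) ^ 2)) (by simpa using hr0)
    convert! key using 1
    have hφ : ∀ z : ℂ, φ (C z) = Polynomial.C z := fun z => by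
      rw [← algebraMap_eq, AlgHom.commutes]
      rfl
    have hw' : (Polynomial.C (Polynomial.C w) : Polynomial (Polynomial ℂ)) ^ 2 +
        Polynomial.C (Polynomial.C w) + 1 = 0 := by
      rw [← map_pow, ← map_pow, ← map_add, ← map_add, ← map_one Polynomial.C,
        ← map_one Polynomial.C, ← map_add, ← map_add, hw]
      simp
    have hr' : (Polynomial.C (Polynomial.C r) : Polynomial (Polynomial ℂ)) *
        (2 - 4 * Polynomial.C (Polynomial.C t)) = 1 := by
      have := congrArg (fun z : ℂ => (Polynomial.C (Polynomial.C z) : Polynomial (Polynomial ℂ))) hr1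
      simpa only [map_mul, map_sub, map_ofNat, map_one] using this
    simp only [f, hGf, Polynomial.map_mul, Polynomial.map_add, Polynomial.map_sub,
      Polynomial.map_pow, Polynomial.map_C, Polynomial.map_X, RingHom.coe_coe, hφ]
    simp [φ]
    simp only [map_ofNat]
    generalize (Polynomial.C (Polynomial.C w) : Polynomial (Polynomial ℂ)) = W at *
    generalize (Polynomial.C (Polynomial.C r) : Polynomial (Polynomial ℂ)) = r' at *
    generalize (Polynomial.C (Polynomial.C t) : Polynomial (Polynomial ℂ)) = t' at *
    generalize (Polynomial.C Polynomial.X : Polynomial (Polynomial ℂ)) = Z at *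
    linear_combination 2 * r' * (W ^ 2 + W + 1 - t' * (2 * (2 * Polynomial.X ^ 2 + 2 * Z ^ 2 +
      2 * Z) + 2 * (W ^ 2 + W + 1))) * hw' + Polynomial.X ^ 4 * hr'
  have hprime : Prime G := by
    have h1 : G ∣ f := Dvd.intro_left _ rfl
    have h2 : f ∣ G := ⟨Polynomial.C (C (2 - 4 * t)), by
      simp only [f]
      have : Polynomial.C (C r) * Polynomial.C (C (2 - 4 * t)) =
          (1 : Polynomial (MvPolynomial (Fin 4) ℂ)) := by
        rw [← map_mul, ← map_mul, hr1, map_one, map_one]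
      linear_combination (-G) * this⟩
    exact (associated_of_dvd_dvd h1 h2).prime_iff.2 hirr.prime
  rw [quarticIdeal_eq_comap]
  have := (Ideal.span_singleton_prime hprime.ne_zero).2 hprime
  exact Ideal.comap_isPrime _ _

end Prime

/-! ### Affine charts of the quartic threefolds -/

section Geometry

/-- The `Proj` of a graded domain is irreducible: the zero ideal is a generic point. -/
theorem preirreducibleSpace_proj {A σ : Type} [CommRing A] [IsDomain A] [SetLike σ A]
    [AddSubgroupClass σ A] (𝒜 : ℕ → σ) [GradedRing 𝒜] : PreirreducibleSpace (Proj 𝒜) := by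
  by_cases h : Nonempty (Proj 𝒜)
  · obtain ⟨x⟩ := h
    let η : Proj 𝒜 :=
      { asHomogeneousIdeal := ⊥
        isPrime := by
          rw [HomogeneousIdeal.toIdeal_bot]
          exact Ideal.isPrime_bot
        not_irrelevant_le := fun hle => x.not_irrelevant_le (hle.trans bot_le) }
    have hη : closure {η} = Set.univ := by
      rw [Set.eq_univ_iff_forall]
      intro z
      exact (ProjectiveSpectrum.le_iff_mem_closure (𝒜 := 𝒜) η z).1
        (show η.asHomogeneousIdeal ≤ _ from bot_le)
    exact ⟨by rw [← hη]; exact (isIrreducible_singleton.closure).isPreirreducible⟩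
  · rw [not_nonempty_iff] at h
    exact ⟨fun _ _ _ _ ⟨z, _⟩ => (h.false z).elim⟩

theorem isDominant_of_isOpenImmersion {X Y : Scheme.{0}} (f : X ⟶ Y) [IsOpenImmersion f]
    [Nonempty X] [PreirreducibleSpace Y] : IsDominant f :=
  ⟨f.isOpenEmbedding.isOpen_range.dense (Set.range_nonempty _)⟩

/-- The `ℂ`-algebra structure on the coordinate ring of a standard affine chart of `X_t`. -/
abbrev quarticChartAlgebra (t : ℂ) (y : MvPolynomial (Fin 6) ℂ ⧸ quarticIdeal t) :
    Algebra ℂ (HomogeneousLocalization.Away (quarticGrading t) y) :=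
  ((HomogeneousLocalization.fromZeroRingHom (quarticGrading t) (.powers y)).comp
    (algebraMap ℂ (quarticGrading t 0))).toAlgebra

/-- A common localization of the coordinate ring of an affine chart of `X_t` and of a polynomial
ring in three variables exhibits `X_t` as a rational variety. -/
theorem birationalOver_of_isLocalization (t : ℂ) [(quarticIdeal t).IsPrime]
    {y : MvPolynomial (Fin 6) ℂ ⧸ quarticIdeal t} (hy : y ∈ quarticGrading t 1)
    {h : MvPolynomial (Fin 3) ℂ} (hh : h ≠ 0)
    (ρ : HomogeneousLocalization.Away (quarticGrading t) y →+* Localization.Away h)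
    (hρ : ρ.comp ((HomogeneousLocalization.fromZeroRingHom (quarticGrading t) (.powers y)).comp
      (algebraMap ℂ (quarticGrading t 0))) =
        (algebraMap (MvPolynomial (Fin 3) ℂ) (Localization.Away h)).comp C)
    (g : HomogeneousLocalization.Away (quarticGrading t) y)
    (hloc : letI := ρ.toAlgebra; IsLocalization.Away g (Localization.Away h)) :
    Scheme.BirationalOver (quarticThreefoldStr t) (𝔸(Fin 3; Spec (.of ℂ)) ↘ Spec (.of ℂ)) := by
  have : Nontrivial (Localization.Away h) :=
    (IsLocalization.injective (Localization.Away h)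
      (powers_le_nonZeroDivisors_of_noZeroDivisors hh)).nontrivial
  have : PreirreducibleSpace (Proj (quarticGrading t)) := preirreducibleSpace_proj _
  let i₁ : Spec (.of (Localization.Away h)) ⟶ Proj (quarticGrading t) :=
    Spec.map (CommRingCat.ofHom ρ) ≫ Proj.awayι (quarticGrading t) y hy one_pos
  let i₂ : Spec (.of (Localization.Away h)) ⟶ 𝔸(Fin 3; Spec (.of ℂ)) :=
    Spec.map (CommRingCat.ofHom (algebraMap _ (Localization.Away h))) ≫
      (AffineSpace.SpecIso (Fin 3) (.of ℂ)).inv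
  have : IsOpenImmersion (Spec.map (CommRingCat.ofHom ρ)) :=
    letI := ρ.toAlgebra
    IsOpenImmersion.of_isLocalization g
  have : IsOpenImmersion (Spec.map (CommRingCat.ofHom
      (algebraMap (MvPolynomial (Fin 3) ℂ) (Localization.Away h)))) :=
    IsOpenImmersion.of_isLocalization h
  have : IsOpenImmersion i₁ := IsOpenImmersion.comp _ _
  have : IsOpenImmersion i₂ := IsOpenImmersion.comp _ _
  have : IsDominant i₁ := isDominant_of_isOpenImmersion _
  have : IsDominant i₂ := isDominant_of_isOpenImmersion _
  change Scheme.BirationalOver (X := Proj (quarticGrading t)) (Proj.toSpecZero (quarticGrading t) ≫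
    Spec.map (CommRingCat.ofHom (algebraMap ℂ (quarticGrading t 0)))) _
  have hi : i₁ ≫ Proj.toSpecZero (quarticGrading t) ≫
      Spec.map (CommRingCat.ofHom (algebraMap ℂ (quarticGrading t 0))) =
        i₂ ≫ 𝔸(Fin 3; Spec (.of ℂ)) ↘ Spec (.of ℂ) := by
    simp only [i₁, i₂, Category.assoc, AffineSpace.SpecIso_inv_over]
    rw [Proj.awayι_toSpecZero_assoc, ← Spec.map_comp, ← Spec.map_comp, ← Spec.map_comp]
    congr 1
    ext z
    exact DFunLike.congr_fun hρ z
  exact (Scheme.Hom.birationalOver i₁ _ _ rfl).symm.trans (Scheme.Hom.birationalOver i₂ _ _ hi.symm)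

theorem isHomogeneous_aeval_smul {σ R S : Type*} [CommSemiring R] [CommSemiring S]
    [Algebra R S] {p : MvPolynomial σ R} {n : ℕ} (hp : p.IsHomogeneous n) (c : S) (g : σ → S) :
    aeval (c • g) p = c ^ n * aeval g p := by
  rw [aeval_def, aeval_def, eval₂_eq, eval₂_eq, Finset.mul_sum]
  refine Finset.sum_congr rfl fun d hd => ?_
  have h1 : ∑ i ∈ d.support, d i = n := by
    have := hp (mem_support_iff.1 hd)
    simpa [Finsupp.weight_apply, Finsupp.sum] using this
  simp only [Pi.smul_apply, smul_eq_mul, mul_pow, Finset.prod_mul_distrib,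
    Finset.prod_pow_eq_pow_sum, h1]
  ring

/-- The function `xᵢ / y` on the chart `y ≠ 0` of `X_t`. -/
def chartCoord (t : ℂ) {y : MvPolynomial (Fin 6) ℂ ⧸ quarticIdeal t}
    (hy : y ∈ quarticGrading t 1) (i : Fin 6) :
    HomogeneousLocalization.Away (quarticGrading t) y :=
  HomogeneousLocalization.Away.mk _ hy 1 (Ideal.Quotient.mk _ (X i))
    ⟨X i, by simpa using isHomogeneous_X ℂ i, rfl⟩

theorem val_mk_mul_pow {A σ : Type*} [CommRing A] [SetLike σ A] [AddSubgroupClass σ A]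
    (𝒜 : ℕ → σ) [GradedRing 𝒜] {f : A} {d : ℕ} (hf : f ∈ 𝒜 d) (n : ℕ) (a : A)
    (ha : a ∈ 𝒜 (n • d)) :
    (HomogeneousLocalization.Away.mk 𝒜 hf n a ha).val * algebraMap A (Localization.Away f) f ^ n =
      algebraMap A (Localization.Away f) a := by
  rw [HomogeneousLocalization.Away.val_mk, ← map_pow, Localization.mk_eq_mk']
  exact IsLocalization.mk'_spec _ a (⟨f ^ n, n, rfl⟩ : Submonoid.powers f)

theorem val_algebraMap_chart (t : ℂ) (y : MvPolynomial (Fin 6) ℂ ⧸ quarticIdeal t) (z : ℂ) :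
    (HomogeneousLocalization.fromZeroRingHom (quarticGrading t) (.powers y)
      (algebraMap ℂ (quarticGrading t 0) z)).val = algebraMap ℂ (Localization.Away y) z := by
  rw [IsScalarTower.algebraMap_apply ℂ (MvPolynomial (Fin 6) ℂ ⧸ quarticIdeal t)
    (Localization.Away y)]
  exact Localization.mk_one_eq_algebraMap _

/-- A form `p` of degree `n` in the affine coordinates `xᵢ / y` equals `p / yⁿ`. -/
theorem val_aeval_chartCoord (t : ℂ) {y : MvPolynomial (Fin 6) ℂ ⧸ quarticIdeal t}
    (hy : y ∈ quarticGrading t 1) {p : MvPolynomial (Fin 6) ℂ} {n : ℕ} (hp : p.IsHomogeneous n) :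
    letI := quarticChartAlgebra t y
    (aeval (chartCoord t hy) p).val * algebraMap _ (Localization.Away y) y ^ n =
      algebraMap _ (Localization.Away y) (Ideal.Quotient.mk (quarticIdeal t) p) := by
  let := quarticChartAlgebra t y
  let v : HomogeneousLocalization.Away (quarticGrading t) y →ₐ[ℂ] Localization.Away y :=
    { algebraMap (HomogeneousLocalization.Away (quarticGrading t) y) (Localization.Away y) with
      commutes' := val_algebraMap_chart t y }
  change v (aeval (chartCoord t hy) p) * _ = _
  have h1 : v (aeval (chartCoord t hy) p) = aeval (fun i => v (chartCoord t hy i)) p := by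
    rw [← AlgHom.comp_apply, comp_aeval]
  rw [h1, mul_comm, ← isHomogeneous_aeval_smul hp]
  let φ : MvPolynomial (Fin 6) ℂ →ₐ[ℂ] Localization.Away y :=
    (IsScalarTower.toAlgHom ℂ _ (Localization.Away y)).comp (Ideal.Quotient.mkₐ ℂ (quarticIdeal t))
  have h2 : (algebraMap _ (Localization.Away y) y • fun i => v (chartCoord t hy i)) =
      φ ∘ X := by
    ext i
    rw [Pi.smul_apply, smul_eq_mul, mul_comm]
    have := val_mk_mul_pow (quarticGrading t) hy 1 (Ideal.Quotient.mk _ (X i))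
      ⟨X i, by simpa using isHomogeneous_X ℂ i, rfl⟩
    rw [pow_one] at this
    exact this
  rw [h2, ← aeval_unique φ]
  rfl

theorem adjoin_chartCoord (t : ℂ) {y : MvPolynomial (Fin 6) ℂ ⧸ quarticIdeal t}
    (hy : y ∈ quarticGrading t 1) :
    letI := quarticChartAlgebra t y
    Algebra.adjoin ℂ (Set.range (chartCoord t hy)) = ⊤ := by
  let := quarticChartAlgebra t y
  rw [Algebra.adjoin_range_eq_range_aeval, AlgHom.range_eq_top]
  intro r
  obtain ⟨n, a, ha, rfl⟩ := HomogeneousLocalization.Away.mk_surjective _ hy r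
  obtain ⟨p, hp, hpa⟩ := id ha
  refine ⟨p, HomogeneousLocalization.val_injective _ ?_⟩
  have hy' : IsUnit (algebraMap _ (Localization.Away y) y) :=
    IsLocalization.Away.algebraMap_isUnit y
  have hp' : p.IsHomogeneous n := by simpa using hp
  refine (hy'.pow n).mul_right_cancel ?_
  rw [val_mk_mul_pow, ← hpa]
  exact val_aeval_chartCoord t hy hp'

/-- The affine coordinates on a chart of `X_t` satisfy the equations of `X_t`. -/
theorem aeval_chartCoord_eq_zero (t : ℂ) {y : MvPolynomial (Fin 6) ℂ ⧸ quarticIdeal t}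
    (hy : y ∈ quarticGrading t 1) {p : MvPolynomial (Fin 6) ℂ} {n : ℕ} (hp : p.IsHomogeneous n)
    (hpI : p ∈ quarticIdeal t) :
    letI := quarticChartAlgebra t y
    aeval (chartCoord t hy) p = 0 := by
  let := quarticChartAlgebra t y
  have hy' : IsUnit (algebraMap _ (Localization.Away y) y) :=
    IsLocalization.Away.algebraMap_isUnit y
  refine HomogeneousLocalization.val_injective _ ((hy'.pow n).mul_right_cancel ?_)
  refine (val_aeval_chartCoord t hy hp).trans ?_
  rw [Ideal.Quotient.eq_zero_iff_mem.2 hpI, map_zero, HomogeneousLocalization.val_zero, zero_mul]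

/-- A point of `X_t` with values in `S` at which the linear form `p` takes the value `1` is a
homomorphism from the coordinate ring of the chart `p ≠ 0`. -/
theorem exists_chart_lift (t : ℂ) {S : Type} [CommRing S] [Algebra ℂ S]
    {p : MvPolynomial (Fin 6) ℂ}
    (hy : Ideal.Quotient.mk (quarticIdeal t) p ∈ quarticGrading t 1) (x : Fin 6 → S)
    (hx : aeval x hyperplaneForm = 0) (hx' : aeval x (quarticForm t) = 0) (hp : aeval x p = 1) :
    letI := quarticChartAlgebra t (Ideal.Quotient.mk (quarticIdeal t) p)
    ∃ ρ : HomogeneousLocalization.Away (quarticGrading t) (Ideal.Quotient.mk (quarticIdeal t) p)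
      →ₐ[ℂ] S, ∀ i, ρ (chartCoord t hy i) = x i := by
  set y := Ideal.Quotient.mk (quarticIdeal t) p with hyp
  let := quarticChartAlgebra t y
  have hle : quarticIdeal t ≤ RingHom.ker (aeval x : MvPolynomial (Fin 6) ℂ →ₐ[ℂ] S) := by
    refine Ideal.span_le.2 ?_
    rintro _ (rfl | rfl)
    · exact hx
    · exact hx'
  let ρA : MvPolynomial (Fin 6) ℂ ⧸ quarticIdeal t →ₐ[ℂ] S :=
    Ideal.Quotient.liftₐ (quarticIdeal t) (aeval x) fun a ha => hle ha
  have hρy : ρA y = 1 := hp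
  have hρx : ∀ i, ρA (Ideal.Quotient.mk _ (X i)) = x i := fun i => aeval_X x i
  have hu : IsUnit ((ρA : MvPolynomial (Fin 6) ℂ ⧸ quarticIdeal t →+* S) y) := by
    change IsUnit (ρA y)
    rw [hρy]
    exact isUnit_one
  let ρ' : Localization.Away y →+* S := IsLocalization.Away.lift y hu
  have hρ' : ∀ a, ρ' (algebraMap _ _ a) = ρA a := fun a => IsLocalization.Away.lift_eq y hu a
  let ρ : HomogeneousLocalization.Away (quarticGrading t) y →ₐ[ℂ] S :=
    { ρ'.comp (algebraMap _ (Localization.Away y)) with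
      commutes' := fun a => by
        rw [← ρA.commutes, ← hρ']
        exact congrArg ρ' (val_algebraMap_chart t y a) }
  refine ⟨ρ, fun i => ?_⟩
  have h1 := congrArg ρ' (val_mk_mul_pow (quarticGrading t) hy 1 (Ideal.Quotient.mk _ (X i))
    ⟨X i, by simpa using isHomogeneous_X ℂ i, rfl⟩)
  rw [map_mul, map_pow, hρ', hρ', hρx, hρy, one_pow, mul_one] at h1
  exact h1

/-- The dehomogenizing linear form equals `1` on its chart. -/
theorem aeval_chartCoord_eq_one (t : ℂ) {p : MvPolynomial (Fin 6) ℂ}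
    (hy : Ideal.Quotient.mk (quarticIdeal t) p ∈ quarticGrading t 1) (hp : p.IsHomogeneous 1) :
    letI := quarticChartAlgebra t (Ideal.Quotient.mk (quarticIdeal t) p)
    aeval (chartCoord t hy) p = 1 := by
  let := quarticChartAlgebra t (Ideal.Quotient.mk (quarticIdeal t) p)
  have hu : IsUnit (algebraMap _ (Localization.Away (Ideal.Quotient.mk (quarticIdeal t) p))
      (Ideal.Quotient.mk (quarticIdeal t) p)) := IsLocalization.Away.algebraMap_isUnit _
  have h1 := val_aeval_chartCoord t hy hp
  rw [pow_one] at h1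
  refine HomogeneousLocalization.val_injective _ (hu.mul_right_cancel (h1.trans ?_))
  rw [HomogeneousLocalization.val_one, one_mul]

end Geometry

/-! ### Rationality of determinantal quartic threefolds -/

section Determinantal

/-- A determinantal representation of the quartic form, checked on complex points, holds for points
with values in every `ℂ`-algebra. -/
theorem aeval_quarticForm_of_det {t κ : ℂ} {T : Fin 5 → Matrix (Fin 4) (Fin 4) ℂ}
    {L : Fin 6 → Fin 5 → ℂ}
    (hdet : ∀ y : Fin 5 → ℂ,
      aeval (fun i => ∑ j, L i j • y j) (quarticForm t) = κ * (pencil T y).det)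
    {R : Type*} [CommRing R] [Algebra ℂ R] (y : Fin 5 → R) :
    aeval (fun i => ∑ j, L i j • y j) (quarticForm t) = κ • (pencil T y).det := by
  have key : aeval (fun i => ∑ j, L i j • (X j : MvPolynomial (Fin 5) ℂ)) (quarticForm t) =
      κ • (pencil T (X : Fin 5 → MvPolynomial (Fin 5) ℂ)).det := by
    refine MvPolynomial.funext fun z => ?_
    let f : MvPolynomial (Fin 5) ℂ →ₐ[ℂ] ℂ := aeval z
    change f _ = f _
    rw [← AlgHom.comp_apply, comp_aeval, map_smul, smul_eq_mul]
    have h1 : f (pencil T X).det = (pencil T z).det := by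
      rw [AlgHom.map_det, AlgHom.mapMatrix_apply, map_pencil]
      simp [f]
    rw [h1, ← hdet]
    simp [f]
  let f : MvPolynomial (Fin 5) ℂ →ₐ[ℂ] R := aeval y
  have h1 : f (pencil T X).det = (pencil T y).det := by
    rw [AlgHom.map_det, AlgHom.mapMatrix_apply, map_pencil]
    simp [f]
  rw [← h1, ← map_smul, ← key, ← AlgHom.comp_apply, comp_aeval]
  simp [f]

/-- The affine coordinate ring `R₀` of the chart `Y₀ ≠ 0` of a determinantal `X_t`, with
coordinates `c`, has a common localization with a polynomial ring in three variables. The chart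
is described by its universal property `hlift`. -/
theorem exists_isLocalization_away_of_det {t κ : ℂ} (hκ : κ ≠ 0)
    (T : Fin 5 → Matrix (Fin 4) (Fin 4) ℂ) (L : Fin 6 → Fin 5 → ℂ) (Y : Fin 5 → Fin 6 → ℂ)
    (r : Fin 6 → ℂ) (hL : ∀ j, ∑ i, L i j = 0)
    (hYL : ∀ j k, ∑ i, Y j i * L i k = if j = k then 1 else 0)
    (hLY : ∀ i k, ∑ j, L i j * Y j k = (if i = k then 1 else 0) + r i)
    (hdet : ∀ y : Fin 5 → ℂ,
      aeval (fun i => ∑ j, L i j • y j) (quarticForm t) = κ * (pencil T y).det)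
    {R₀ S : Type} [CommRing R₀] [Algebra ℂ R₀] [CommRing S] [Algebra ℂ S]
    [Algebra (MvPolynomial (Fin 3) ℂ) S] [IsScalarTower ℂ (MvPolynomial (Fin 3) ℂ) S]
    [IsLocalization.Away (chartPoly T) S] (c : Fin 6 → R₀)
    (hc : aeval c hyperplaneForm = 0) (hc' : aeval c (quarticForm t) = 0)
    (hc0 : aeval c (∑ i, Y 0 i • X i : MvPolynomial (Fin 6) ℂ) = 1)
    (hgen : Algebra.adjoin ℂ (Set.range c) = ⊤)
    (hlift : ∀ x : Fin 6 → S, aeval x hyperplaneForm = 0 → aeval x (quarticForm t) = 0 →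
      aeval x (∑ i, Y 0 i • X i : MvPolynomial (Fin 6) ℂ) = 1 →
      ∃ ρ : R₀ →ₐ[ℂ] S, ∀ i, ρ (c i) = x i) :
    ∃ (ρ : R₀ →ₐ[ℂ] S) (g : R₀), letI := ρ.toAlgebra; IsLocalization.Away g S := by
  let ι : MvPolynomial (Fin 3) ℂ →ₐ[ℂ] S := IsScalarTower.toAlgHom ℂ _ S
  -- The parametrization of the quartic, normalized to have zeroth coordinate `1`.
  have hunit : IsUnit (ι (genericImage T 0)) := by
    have : IsUnit (ι (chartPoly T)) := IsLocalization.Away.algebraMap_isUnit _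
    rw [chartPoly, map_mul] at this
    exact isUnit_of_mul_isUnit_left this
  obtain ⟨e, he⟩ := hunit.exists_right_inv
  let p : Fin 5 → S := fun j => ι (genericImage T j) * e
  have hpdet : (pencil T p).det = 0 := by
    have h1 : p = e • fun j => ι (genericImage T j) := by
      ext j
      simp [p, mul_comm]
    have h2 : (pencil T (genericImage T)).det = 0 := det_pencil_ofKernel T rfl
    rw [h1, pencil_smul, Matrix.det_smul, ← map_pencil, ← AlgHom.mapMatrix_apply, ← AlgHom.map_det,
      h2, map_zero, mul_zero]
  let x : Fin 6 → S := fun i => ∑ j, L i j • p j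
  have hYx : ∀ j, ∑ i, Y j i • x i = p j := fun j => by
    simp only [x, Finset.smul_sum, smul_smul]
    rw [Finset.sum_comm]
    simp [← Finset.sum_smul, hYL]
  obtain ⟨ρ, hρ⟩ := hlift x
    (by
      simp only [hyperplaneForm, map_sum, aeval_X, x]
      rw [Finset.sum_comm]
      simp [← Finset.sum_smul, hL])
    (by rw [aeval_quarticForm_of_det hdet, hpdet, smul_zero])
    (by simp only [map_sum, map_smul, aeval_X, hYx, p, he])
  let τ : Fin 5 → R₀ := fun j => ∑ i, Y j i • c i
  have hcsum : ∑ i, c i = 0 := by simpa [hyperplaneForm] using hc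
  have hcτ : ∀ i, ∑ j, L i j • τ j = c i := fun i => by
    simp only [τ, Finset.smul_sum, smul_smul]
    rw [Finset.sum_comm]
    simp only [← Finset.sum_smul, hLY, add_smul, Finset.sum_add_distrib, ← Finset.smul_sum, hcsum]
    simp
  have hτ0 : τ 0 = 1 := by simpa [τ] using hc0
  have hτdet : (pencil T τ).det = 0 := by
    have h3 := aeval_quarticForm_of_det hdet τ
    simp only [hcτ] at h3
    rw [hc'] at h3
    exact (smul_eq_zero_iff_right hκ).1 h3.symm
  have hgenτ : Algebra.adjoin ℂ (Set.range τ) = ⊤ := by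
    rw [eq_top_iff, ← hgen]
    refine Algebra.adjoin_le ?_
    rintro _ ⟨i, rfl⟩
    rw [← hcτ i]
    exact Subalgebra.sum_mem _ fun j _ => Subalgebra.smul_mem _
      (Algebra.subset_adjoin (Set.mem_range_self j)) _
  refine ⟨ρ, _, isLocalization_away_chart T (S := S) τ hτ0 hτdet hgenτ ρ fun j => ?_⟩
  have hρτ : ρ (τ j) = p j := by simp only [τ, map_sum, map_smul, hρ, hYx]
  change ρ (τ j) * ι _ = ι _
  rw [hρτ]
  linear_combination ι (genericImage T j) * he

/-- If the equation of `X_t` is, up to a linear change of coordinates on the hyperplane `∑ xᵢ = 0`,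
the determinant of a `4 × 4` matrix of linear forms, then `X_t` is rational, provided that at some
point `z` of `X_t`, with kernel vector `v`, neither the kernel map nor the parametrization of the
quartic by its kernel vectors degenerates. -/
theorem birationalOver_of_det {t κ : ℂ} (ht : 2 - 4 * t ≠ 0) (hκ : κ ≠ 0)
    (T : Fin 5 → Matrix (Fin 4) (Fin 4) ℂ) (L : Fin 6 → Fin 5 → ℂ) (Y : Fin 5 → Fin 6 → ℂ)
    (r : Fin 6 → ℂ) (hL : ∀ j, ∑ i, L i j = 0)
    (hYL : ∀ j k, ∑ i, Y j i * L i k = if j = k then 1 else 0)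
    (hLY : ∀ i k, ∑ j, L i j * Y j k = (if i = k then 1 else 0) + r i)
    (hdet : ∀ y : Fin 5 → ℂ,
      aeval (fun i => ∑ j, L i j • y j) (quarticForm t) = κ * (pencil T y).det)
    {v : Fin 4 → ℂ} {z : Fin 5 → ℂ} (hv : v 0 = 1) (hz : z 0 = 1)
    (hzv : (pencil T z).mulVec v = 0) (h₁ : ofKernel T v 0 ≠ 0) (h₂ : toKernel T z 0 ≠ 0) :
    Scheme.BirationalOver (quarticThreefoldStr t) (𝔸(Fin 3; Spec (.of ℂ)) ↘ Spec (.of ℂ)) := by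
  have hI := quarticIdeal_isPrime t ht
  have hh : chartPoly T ≠ 0 := chartPoly_ne_zero T hv hz hzv h₁ h₂
  let p : MvPolynomial (Fin 6) ℂ := ∑ i, Y 0 i • X i
  have hp : p.IsHomogeneous 1 :=
    IsHomogeneous.sum _ _ _ fun i _ => by
      rw [smul_eq_C_mul]
      exact (isHomogeneous_X ℂ i).C_mul _
  have hy : Ideal.Quotient.mk (quarticIdeal t) p ∈ quarticGrading t 1 := ⟨p, hp, rfl⟩
  let := quarticChartAlgebra t (Ideal.Quotient.mk (quarticIdeal t) p)
  obtain ⟨ρ, g, hloc⟩ := exists_isLocalization_away_of_det hκ T L Y r hL hYL hLY hdet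
    (S := Localization.Away (chartPoly T)) (chartCoord t hy)
    (aeval_chartCoord_eq_zero t hy hyperplaneForm_isHomogeneous
      (Ideal.subset_span (Set.mem_insert _ _)))
    (aeval_chartCoord_eq_zero t hy (quarticForm_isHomogeneous t)
      (Ideal.subset_span (Set.mem_insert_of_mem _ rfl)))
    (aeval_chartCoord_eq_one t hy hp) (adjoin_chartCoord t hy)
    (fun x hx hx' hx0 => exists_chart_lift t hy x hx hx' hx0)
  refine birationalOver_of_isLocalization t hy hh (ρ : _ →+* Localization.Away (chartPoly T))
    (RingHom.ext fun a => ρ.commutes a) g hloc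

end Determinantal

/-! ### Explicit determinantal representations -/

section Explicit

/-- The coordinates `x₀, …, x₅` on the hyperplane `∑ xᵢ = 0` in terms of coordinates
`(e, a, g, b, c)`. Here `w` is a primitive cube root of unity; up to scalars, `b`, `c`, `e` are the
differences of the pairs `x₀, x₁` and `x₂, x₃` and `x₄, x₅`, while `a` and `g` are the nontrivial
discrete Fourier coefficients of the sums of these pairs. The scalars are chosen to keep the
imaginary unit out of the matrices below, and `e` comes first because the affine chart used is
`e ≠ 0`. -/
def fourierMatrix (w : ℂ) : Fin 6 → Fin 5 → ℂ :=
  ![![0, Complex.I / 3 * w ^ 2, -Complex.I * w, 1, 0],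
    ![0, Complex.I / 3 * w ^ 2, -Complex.I * w, -1, 0],
    ![0, Complex.I / 3 * w, -Complex.I * w ^ 2, 0, -Complex.I],
    ![0, Complex.I / 3 * w, -Complex.I * w ^ 2, 0, Complex.I],
    ![1, Complex.I / 3, -Complex.I, 0, 0],
    ![-1, Complex.I / 3, -Complex.I, 0, 0]]

/-- The inverse coordinate change of `fourierMatrix`. -/
def fourierMatrixInv (w : ℂ) : Fin 5 → Fin 6 → ℂ :=
  ![![0, 0, 0, 0, 1 / 2, -1 / 2],
    ![-Complex.I / 2 * w, -Complex.I / 2 * w, -Complex.I / 2 * w ^ 2, -Complex.I / 2 * w ^ 2,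
      -Complex.I / 2, -Complex.I / 2],
    ![Complex.I / 6 * w ^ 2, Complex.I / 6 * w ^ 2, Complex.I / 6 * w, Complex.I / 6 * w,
      Complex.I / 6, Complex.I / 6],
    ![1 / 2, -1 / 2, 0, 0, 0, 0],
    ![0, 0, Complex.I / 2, -Complex.I / 2, 0, 0]]

theorem sum_fourierMatrix {w : ℂ} (hw : w ^ 2 + w + 1 = 0) (j : Fin 5) :
    ∑ i, fourierMatrix w i j = 0 := by
  fin_cases j <;> simp [fourierMatrix, Fin.sum_univ_six] <;> grind

theorem fourierMatrixInv_mul {w : ℂ} (hw : w ^ 2 + w + 1 = 0) (j k : Fin 5) :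
    ∑ i, fourierMatrixInv w j i * fourierMatrix w i k = if j = k then 1 else 0 := by
  have hI := Complex.I_sq
  fin_cases j <;> fin_cases k <;>
    simp [fourierMatrix, fourierMatrixInv, Fin.sum_univ_six] <;> grind

theorem fourierMatrix_mul_inv {w : ℂ} (hw : w ^ 2 + w + 1 = 0) (i k : Fin 6) :
    ∑ j, fourierMatrix w i j * fourierMatrixInv w j k =
      (if i = k then 1 else 0) + (fun _ => -1 / 6 : Fin 6 → ℂ) i := by
  have hI := Complex.I_sq
  fin_cases i <;> fin_cases k <;>
    simp [fourierMatrix, fourierMatrixInv, Fin.sum_univ_five] <;> grind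

/-- The quartic form in the Fourier coordinates. The quadratic forms that occur are the
Fourier coefficients of the squares of the differences `x₀ - x₁`, `x₂ - x₃`, `x₄ - x₅`. -/
theorem quarticForm_fourier {w : ℂ} (hw : w ^ 2 + w + 1 = 0) (t : ℂ) (y : Fin 5 → ℂ) :
    aeval (fun i => ∑ j, fourierMatrix w i j • y j) (quarticForm t) =
      4 * y 1 ^ 2 * y 2 ^ 2 + 4 / 3 * (- y 1 ^ 2 * (w * y 3 ^ 2 - w ^ 2 * y 4 ^ 2 + y 0 ^ 2) -
        9 * y 2 ^ 2 * (w ^ 2 * y 3 ^ 2 - w * y 4 ^ 2 + y 0 ^ 2) +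
        6 * y 1 * y 2 * (y 3 ^ 2 - y 4 ^ 2 + y 0 ^ 2)) +
      2 / 3 * (y 3 ^ 2 - y 4 ^ 2 + y 0 ^ 2) ^ 2 +
      4 / 3 * ((w * y 3 ^ 2 - w ^ 2 * y 4 ^ 2 + y 0 ^ 2) *
        (w ^ 2 * y 3 ^ 2 - w * y 4 ^ 2 + y 0 ^ 2)) -
      t * (4 * y 1 * y 2 + 2 * (y 3 ^ 2 - y 4 ^ 2 + y 0 ^ 2)) ^ 2 := by
  have hI := Complex.I_sq
  generalize he : y 0 = e
  generalize ha : y 1 = a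
  generalize hg : y 2 = g
  generalize hb : y 3 = b
  generalize hc : y 4 = c
  have h4 : (Complex.I / 3 * (w ^ 2 * a - 3 * w * g) + b) ^ 4 +
      (Complex.I / 3 * (w ^ 2 * a - 3 * w * g) - b) ^ 4 +
      (Complex.I / 3 * (w * a - 3 * w ^ 2 * g) - Complex.I * c) ^ 4 +
      (Complex.I / 3 * (w * a - 3 * w ^ 2 * g) + Complex.I * c) ^ 4 +
      (Complex.I / 3 * (a - 3 * g) + e) ^ 4 + (Complex.I / 3 * (a - 3 * g) - e) ^ 4 =
      4 * a ^ 2 * g ^ 2 + 4 / 3 * (- a ^ 2 * (w * b ^ 2 - w ^ 2 * c ^ 2 + e ^ 2) -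
        9 * g ^ 2 * (w ^ 2 * b ^ 2 - w * c ^ 2 + e ^ 2) + 6 * a * g * (b ^ 2 - c ^ 2 + e ^ 2)) +
      2 / 3 * (b ^ 2 - c ^ 2 + e ^ 2) ^ 2 +
      4 / 3 * ((w * b ^ 2 - w ^ 2 * c ^ 2 + e ^ 2) * (w ^ 2 * b ^ 2 - w * c ^ 2 + e ^ 2)) := by
    grind
  have h2 : (Complex.I / 3 * (w ^ 2 * a - 3 * w * g) + b) ^ 2 +
      (Complex.I / 3 * (w ^ 2 * a - 3 * w * g) - b) ^ 2 +
      (Complex.I / 3 * (w * a - 3 * w ^ 2 * g) - Complex.I * c) ^ 2 +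
      (Complex.I / 3 * (w * a - 3 * w ^ 2 * g) + Complex.I * c) ^ 2 +
      (Complex.I / 3 * (a - 3 * g) + e) ^ 2 + (Complex.I / 3 * (a - 3 * g) - e) ^ 2 =
      4 * a * g + 2 * (b ^ 2 - c ^ 2 + e ^ 2) := by
    grind
  rw [← h4, ← h2]
  simp only [quarticForm, map_sub, map_mul, map_pow, Fin.sum_univ_six,
    Fin.sum_univ_five, smul_eq_mul, he, ha, hg, hb, hc, fourierMatrix, ← algebraMap_eq,
    AlgHom.commutes, Algebra.algebraMap_self_apply]
  simp
  ring

/-- Every linear map to matrices is the pencil of its values at the basis vectors. -/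
theorem pencil_linearMap (f : (Fin 5 → ℂ) →ₗ[ℂ] Matrix (Fin 4) (Fin 4) ℂ) (y : Fin 5 → ℂ) :
    pencil (fun j => f (Pi.single j 1)) y = f y := by
  rw [LinearMap.pi_apply_eq_sum_univ f y, pencil]
  refine Finset.sum_congr rfl fun j _ => ?_
  have h : (fun k => if j = k then 1 else 0) = (Pi.single j 1 : Fin 5 → ℂ) := by
    ext k
    simp [Pi.single_apply, eq_comm]
  rw [h]
  congr 1

theorem ofKernel_linearMap_zero (f : (Fin 5 → ℂ) →ₗ[ℂ] Matrix (Fin 4) (Fin 4) ℂ) (v : Fin 4 → ℂ) :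
    ofKernel (fun j => f (Pi.single j 1)) v 0 =
      (Matrix.of fun i k : Fin 4 => (f (Pi.single k.succ 1)).mulVec v i).det := by
  rw [ofKernel, topCofactors, Matrix.adjugate_fin_succ_eq_det_submatrix]
  simp only [Fin.val_zero, add_zero, pow_zero, one_mul]
  rfl

/-- A matrix of linear forms with determinant proportional to the equation of `X_{1/6}`. Up to the
order of its rows and columns, which is chosen so that `(1, 1, 0, 0)` is a convenient kernel vector,
it consists of the `2 × 2` blocks `a`, `3 g + v'`, `v` and `g + v'`, where
`v = !![e, w b - w² c; w b + w² c, -e]` and `v'` is obtained from `v` by exchanging `w` and `w²`. -/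
def oneSixthMatrix (w : ℂ) : (Fin 5 → ℂ) →ₗ[ℂ] Matrix (Fin 4) (Fin 4) ℂ where
  toFun y :=
    !![y 1, 3 * y 2 - y 0, 0, w ^ 2 * y 3 + w * y 4;
      -y 0, y 2 - y 0, w * y 3 + w ^ 2 * y 4, w ^ 2 * y 3 + w * y 4;
      0, w ^ 2 * y 3 - w * y 4, y 1, 3 * y 2 + y 0;
      w * y 3 - w ^ 2 * y 4, w ^ 2 * y 3 - w * y 4, y 0, y 2 + y 0]
  map_add' y z := by
    ext i j
    fin_cases i <;> fin_cases j <;> simp <;> ring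
  map_smul' s y := by
    ext i j
    fin_cases i <;> fin_cases j <;> simp <;> ring

/-- A matrix of linear forms with determinant proportional to the equation of `X_{7/10}` if
`r² = -5/3`. In the order of rows and columns and in the notation of `oneSixthMatrix`, it consists of
the `2 × 2` blocks `q`, `a + r v`, `3 g + r v'` and `-(2/3) q`, where
`q = !![e, b - c; b + c, -e]`. -/
def sevenTenthsMatrix (w r : ℂ) : (Fin 5 → ℂ) →ₗ[ℂ] Matrix (Fin 4) (Fin 4) ℂ where
  toFun y :=
    !![-y 0, y 1 - r * y 0, y 3 + y 4, r * (w * y 3 + w ^ 2 * y 4);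
      3 * y 2 - r * y 0, 2 / 3 * y 0, r * (w ^ 2 * y 3 + w * y 4), -2 / 3 * (y 3 + y 4);
      y 3 - y 4, r * (w * y 3 - w ^ 2 * y 4), y 0, y 1 + r * y 0;
      r * (w ^ 2 * y 3 - w * y 4), -2 / 3 * (y 3 - y 4), 3 * y 2 + r * y 0, -2 / 3 * y 0]
  map_add' y z := by
    ext i j
    fin_cases i <;> fin_cases j <;> simp <;> ring
  map_smul' s y := by
    ext i j
    fin_cases i <;> fin_cases j <;> simp <;> ring

theorem det_oneSixthMatrix {w : ℂ} (hw : w ^ 2 + w + 1 = 0) (y : Fin 5 → ℂ) :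
    (oneSixthMatrix w y).det =
      y 1 ^ 2 * y 2 ^ 2 - y 1 ^ 2 * (w * y 3 ^ 2 - w ^ 2 * y 4 ^ 2 + y 0 ^ 2) -
      9 * y 2 ^ 2 * (w ^ 2 * y 3 ^ 2 - w * y 4 ^ 2 + y 0 ^ 2) +
      (w * y 3 ^ 2 - w ^ 2 * y 4 ^ 2 + y 0 ^ 2) * (w ^ 2 * y 3 ^ 2 - w * y 4 ^ 2 + y 0 ^ 2) +
      4 * y 1 * y 2 * (y 3 ^ 2 - y 4 ^ 2 + y 0 ^ 2) := by
  simp [oneSixthMatrix, Matrix.det_succ_row_zero, Fin.sum_univ_succ, Fin.succAbove]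
  grind

theorem det_sevenTenthsMatrix {w r : ℂ} (hw : w ^ 2 + w + 1 = 0) (hr : r ^ 2 = -5 / 3)
    (y : Fin 5 → ℂ) :
    (sevenTenthsMatrix w r y).det =
      9 * y 1 ^ 2 * y 2 ^ 2 + 5 / 3 * y 1 ^ 2 * (w * y 3 ^ 2 - w ^ 2 * y 4 ^ 2 + y 0 ^ 2) +
      15 * y 2 ^ 2 * (w ^ 2 * y 3 ^ 2 - w * y 4 ^ 2 + y 0 ^ 2) +
      4 * y 1 * y 2 * (y 3 ^ 2 - y 4 ^ 2 + y 0 ^ 2) +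
      8 / 3 * (y 3 ^ 2 - y 4 ^ 2 + y 0 ^ 2) ^ 2 -
      5 / 3 * ((w * y 3 ^ 2 - w ^ 2 * y 4 ^ 2 + y 0 ^ 2) *
        (w ^ 2 * y 3 ^ 2 - w * y 4 ^ 2 + y 0 ^ 2)) := by
  simp [sevenTenthsMatrix, Matrix.det_succ_row_zero, Fin.sum_univ_succ, Fin.succAbove]
  grind

theorem quarticThreefold_one_sixth_rational :
    Scheme.BirationalOver (quarticThreefoldStr (1 / 6)) (𝔸(Fin 3; Spec (.of ℂ)) ↘ Spec (.of ℂ)) := by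
  obtain ⟨w, hw⟩ := exists_primitive_cube_root
  refine birationalOver_of_det (κ := 4 / 3) (by norm_num) (by norm_num)
    (fun j => oneSixthMatrix w (Pi.single j 1)) (fourierMatrix w) (fourierMatrixInv w) _
    (sum_fourierMatrix hw) (fourierMatrixInv_mul hw) (fourierMatrix_mul_inv hw) (fun y => ?_)
    (v := ![1, 1, 0, 0]) (z := ![1, -5, 2, 0, 0]) rfl rfl ?_ ?_ ?_
  · rw [quarticForm_fourier hw, pencil_linearMap, det_oneSixthMatrix hw]
    ring
  · rw [pencil_linearMap]
    ext i
    fin_cases i <;> simp [oneSixthMatrix, Matrix.mulVec, dotProduct, Fin.sum_univ_four] <;> norm_num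
  · have : ofKernel (fun j => oneSixthMatrix w (Pi.single j 1))
        (![1, 1, 0, 0] : Fin 4 → ℂ) 0 = w ^ 2 - w := by
      rw [ofKernel_linearMap_zero]
      have h : (Matrix.of fun i k : Fin 4 =>
          (oneSixthMatrix w (Pi.single k.succ 1)).mulVec ![1, 1, 0, 0] i) =
          !![1, 3, 0, 0; 0, 1, 0, 0; 0, 0, w ^ 2, -w; 0, 0, w + w ^ 2, -w ^ 2 - w] := by
        ext i k
        fin_cases i <;> fin_cases k <;>
          simp [oneSixthMatrix, Matrix.mulVec, dotProduct, Fin.sum_univ_four, Pi.single_apply] <;>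
          ring
      rw [h]
      simp [Matrix.det_succ_row_zero, Fin.sum_univ_succ, Fin.succAbove]
      grind
    rw [this]
    grind
  · have : toKernel (fun j => oneSixthMatrix w (Pi.single j 1))
        (![1, -5, 2, 0, 0] : Fin 5 → ℂ) 0 = -22 := by
      simp only [toKernel, pencil_linearMap]
      simp [topCofactors, Matrix.adjugate_fin_succ_eq_det_submatrix,
        oneSixthMatrix, Matrix.det_succ_row_zero, Fin.sum_univ_succ, Fin.succAbove]
      norm_num
    rw [this]
    norm_num

theorem quarticThreefold_seven_tenths_rational :
    Scheme.BirationalOver (quarticThreefoldStr (7 / 10)) (𝔸(Fin 3; Spec (.of ℂ)) ↘ Spec (.of ℂ)) := by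
  obtain ⟨w, hw⟩ := exists_primitive_cube_root
  obtain ⟨r, hr⟩ := IsAlgClosed.exists_pow_nat_eq (-5 / 3 : ℂ) (n := 2) (by norm_num)
  refine birationalOver_of_det (κ := -4 / 5) (by norm_num) (by norm_num)
    (fun j => sevenTenthsMatrix w r (Pi.single j 1)) (fourierMatrix w) (fourierMatrixInv w) _
    (sum_fourierMatrix hw) (fourierMatrixInv_mul hw) (fourierMatrix_mul_inv hw) (fun y => ?_)
    (v := ![1, 1, 0, 0]) (z := ![1, 1 + r, (r - 2 / 3) / 3, 0, 0]) rfl rfl ?_ ?_ ?_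
  · rw [quarticForm_fourier hw, pencil_linearMap, det_sevenTenthsMatrix hw hr]
    ring
  · rw [pencil_linearMap]
    ext i
    fin_cases i <;> simp [sevenTenthsMatrix, Matrix.mulVec, dotProduct, Fin.sum_univ_four] <;> ring
  · have : ofKernel (fun j => sevenTenthsMatrix w r (Pi.single j 1))
        (![1, 1, 0, 0] : Fin 4 → ℂ) 0 =
        (w ^ 2 - w) * (r + 5) := by
      rw [ofKernel_linearMap_zero]
      have h : (Matrix.of fun i k : Fin 4 =>
          (sevenTenthsMatrix w r (Pi.single k.succ 1)).mulVec ![1, 1, 0, 0] i) =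
          !![1, 0, 0, 0; 0, 3, 0, 0; 0, 0, 1 + r * w, -(1 + r * w ^ 2);
            0, 0, r * w ^ 2 - 2 / 3, -(r * w) + 2 / 3] := by
        ext i k
        fin_cases i <;> fin_cases k <;>
          simp [sevenTenthsMatrix, Matrix.mulVec, dotProduct, Fin.sum_univ_four,
            Pi.single_apply] <;>
          ring
      rw [h]
      simp [Matrix.det_succ_row_zero, Fin.sum_univ_succ, Fin.succAbove]
      grind
    rw [this]
    refine mul_ne_zero ?_ ?_ <;> grind
  · have : toKernel (fun j => sevenTenthsMatrix w r (Pi.single j 1))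
        (![1, 1 + r, (r - 2 / 3) / 3, 0, 0] : Fin 5 → ℂ) 0 = 2 / 3 * (20 / 3 - 2 / 3 * r) := by
      simp only [toKernel, pencil_linearMap]
      simp [topCofactors, Matrix.adjugate_fin_succ_eq_det_submatrix,
        sevenTenthsMatrix, Matrix.det_succ_row_zero, Fin.sum_univ_succ, Fin.succAbove]
      grind
    rw [this]
    grind

end Explicit

end

theorem theorem1p3 :
    Scheme.BirationalOver (quarticThreefoldStr (1 / 6)) (𝔸(Fin 3; Spec (.of ℂ)) ↘ Spec (.of ℂ)) ∧
    Scheme.BirationalOver (quarticThreefoldStr (7 / 10))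
      (𝔸(Fin 3; Spec (.of ℂ)) ↘ Spec (.of ℂ)) :=
  ⟨quarticThreefold_one_sixth_rational, quarticThreefold_seven_tenths_rational⟩
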